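/- All graphs are finite and simple. For a graph $G$ and $S\subseteq V(G)$, let $c(G-S)$ denote the number of connected components of $G-S$; $S$ is a cut set of $G$ if $c(G-S)\ge 2$ (so $S=\emptyset$ is a cut set when $G$ is disconnected). For a real number $t\ge 0$, $G$ is $t$-tough if $t\cdot c(G-S)\le |S|$ for every cut set $S$ of $G$. Let $K_2\cup 3K_1$ be the disjoint union of an edge and three isolated vertices; $G$ is $(K_2\cup 3K_1)$-free if it has no induced subgraph isomorphic to $K_2\cup 3K_1$. $G$ is hamiltonian if it has a cycle containing every vertex of $G$. Theorem. If $G$ is a $3$-tough $(K_2\cup 3K_1)$-free graph on at least $3$ vertices, then $G$ is hamiltonian. -/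

import Mathlib

namespace SimpleGraph

/-- The number `c(G)` of connected components of `G`. -/
noncomputable def numComponents {V : Type*} (G : SimpleGraph V) : ℕ :=
  Nat.card G.ConnectedComponent

/-- `S` is a cut set of `G` if `G - S` is disconnected, i.e. has at least two components. -/
def IsCutSet {V : Type*} (G : SimpleGraph V) (S : Finset V) : Prop :=
  2 ≤ (G.induce (S : Set V)ᶜ).numComponents

/-- `G` is `t`-tough if `t * c(G - S) ≤ |S|` for every cut set `S` of `G`. -/
def IsTough {V : Type*} (G : SimpleGraph V) (t : ℝ) : Prop :=
  ∀ S : Finset V, G.IsCutSet S →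
    t * ((G.induce (S : Set V)ᶜ).numComponents : ℝ) ≤ (S.card : ℝ)

/-- `G` is `H`-free if no induced subgraph of `G` is isomorphic to `H`. -/
def IndFree {W V : Type*} (H : SimpleGraph W) (G : SimpleGraph V) : Prop :=
  ¬ H.IsIndContained G

/-- The graph `K₂ ∪ 3K₁`: the disjoint union of an edge and three isolated vertices. -/
def K2Union3K1 : SimpleGraph (Fin 2 ⊕ Fin 3) :=
  (⊤ : SimpleGraph (Fin 2)) ⊕g (⊥ : SimpleGraph (Fin 3))

end SimpleGraph

/-!
A longest cycle `C` which misses a vertex `x` leads to a contradiction. Let `W` be the set of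
vertices of `C` with a neighbour in the component of `x` in `G - C`, and let `I` be the set of their
successors on `C`. Since `W` is a cut set, `|I| = |W| ≥ 2k` (here `k = 3`), and `I` is independent
because `C` cannot be lengthened. By `(K₂ ∪ kK₁)`-freeness, the set `J` of vertices without a
neighbour in `I` is independent, and a vertex outside `J` misses fewer than `k` vertices of `I`, so
that any two vertices outside `J` have two common neighbours in `I`. Rerouting `C` through these
shows that every vertex outside `J` lies on `C` and has its successor in `J`. Hence succession maps
`V ∖ J` injectively into `J` and misses `x ∈ J`, so `|V ∖ J| < |J|`, while toughness gives
`|J| ≤ |V ∖ J|`.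
-/

section

open SimpleGraph

variable {V : Type*} {G : SimpleGraph V}

/-- The graph `K₂ ∪ kK₁`: the disjoint union of an edge and `k` isolated vertices. -/
def K2UnionK1s (k : ℕ) : SimpleGraph (Fin 2 ⊕ Fin k) :=
  (⊤ : SimpleGraph (Fin 2)) ⊕g (⊥ : SimpleGraph (Fin k))

/-- `l` lists the vertices of a cycle of `G` in cyclic order. A single edge counts as a cycle, so
that a longest cycle exists as soon as `G` has an edge. -/
structure IsCyclicList (G : SimpleGraph V) (l : List V) : Prop where
  nodup : l.Nodup
  exists_walk : ∃ a b, ∃ p : G.Walk a b, p.support = l ∧ G.Adj b a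

/-- `l` lists the vertices of a cycle of `G` of maximum length. -/
def IsLongestCyclicList (G : SimpleGraph V) (l : List V) : Prop :=
  MaximalFor (IsCyclicList G) List.length l

/-- `y` lies in the connected component of `x` in `G - l`. -/
def ReachableOff (G : SimpleGraph V) (l : List V) (x y : V) : Prop :=
  ∃ p : G.Walk x y, p.support.Disjoint l

open Classical in
/-- The vertices of the cycle `l` which have a neighbour in the connected component of `x` in
`G - l`. -/
noncomputable def attachments (G : SimpleGraph V) (l : List V) (x : V) : Finset V :=
  {w ∈ l.toFinset | ∃ y, ReachableOff G l x y ∧ G.Adj y w}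

/-- The successors along the cycle `l` of the attachments of the connected component of `x` in
`G - l`. -/
noncomputable def attachmentSuccs [DecidableEq V] (G : SimpleGraph V) (l : List V) (x : V) :
    Finset V :=
  (attachments G l x).image l.formPerm

theorem isTough_of_le {s t : ℝ} (hst : s ≤ t) (ht : G.IsTough t) : G.IsTough s := fun S hS =>
  (mul_le_mul_of_nonneg_right hst (Nat.cast_nonneg _)).trans (ht S hS)

theorem two_mul_le_card_of_isCutSet {t : ℝ} (ht : 0 ≤ t) (h : G.IsTough t) {S : Finset V}
    (hS : G.IsCutSet S) : 2 * t ≤ S.card := by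
  have hc : (2 : ℝ) ≤ (G.induce (S : Set V)ᶜ).numComponents := by exact_mod_cast hS
  calc 2 * t = t * 2 := mul_comm _ _
    _ ≤ t * (G.induce (S : Set V)ᶜ).numComponents := by gcongr
    _ ≤ S.card := h S hS

theorem isCutSet_of_forall_walk [Finite V] {S : Finset V} {x y : V} (hx : x ∉ S) (hy : y ∉ S)
    (h : ∀ p : G.Walk x y, ∃ v ∈ p.support, v ∈ S) : G.IsCutSet S := by
  have hne : (G.induce (S : Set V)ᶜ).connectedComponentMk ⟨x, hx⟩ ≠
      (G.induce (S : Set V)ᶜ).connectedComponentMk ⟨y, hy⟩ := by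
    intro he
    obtain ⟨p⟩ := ConnectedComponent.exact he
    obtain ⟨v, hv, hvS⟩ := h (p.map (Embedding.induce _).toHom)
    obtain ⟨u, -, rfl⟩ := List.mem_map.mp (p.support_map _ ▸ hv)
    exact u.2 hvS
  have : Nontrivial (G.induce (S : Set V)ᶜ).ConnectedComponent := ⟨_, _, hne⟩
  exact Finite.one_lt_card

theorem numComponents_induce_of_isIndepSet {s : Set V} (hs : G.IsIndepSet s) :
    (G.induce s).numComponents = s.ncard := by
  have hbot : G.induce s = ⊥ := by
    ext u v
    simpa using fun huv : G.Adj u v => hs u.2 v.2 huv.ne huv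
  have hbij : Function.Bijective (G.induce s).connectedComponentMk :=
    ⟨fun u v huv => by simpa [hbot] using ConnectedComponent.exact huv, Quot.mk_surjective⟩
  exact (Nat.card_eq_of_bijective _ hbij).symm

theorem mul_card_le_card_compl_of_isIndepSet [Fintype V] [DecidableEq V] {t : ℝ}
    (h : G.IsTough t) {J : Finset V} (hJ : G.IsIndepSet (J : Set V)) (h2 : 2 ≤ J.card) :
    t * J.card ≤ Jᶜ.card := by
  have hcomp : (G.induce ((Jᶜ : Finset V) : Set V)ᶜ).numComponents = J.card := by
    rw [Finset.coe_compl, compl_compl, numComponents_induce_of_isIndepSet hJ,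
      Set.ncard_coe_finset]
  have hcut : G.IsCutSet Jᶜ := h2.trans_eq hcomp.symm
  simpa only [hcomp] using h Jᶜ hcut

theorem exists_adj_of_isTough [Finite V] [Nontrivial V] {t : ℝ} (ht : 0 < t) (h : G.IsTough t) :
    ∃ a b, G.Adj a b := by
  by_contra! hno
  obtain ⟨a, b, hab⟩ := exists_pair_ne V
  have hcut : G.IsCutSet ∅ := isCutSet_of_forall_walk (x := a) (y := b) (by simp) (by simp) fun
    | .nil => absurd rfl hab
    | .cons hadj _ => absurd hadj (hno _ _)
  have := two_mul_le_card_of_isCutSet ht.le h hcut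
  norm_num at this
  linarith

section Free

variable {k : ℕ} {u v : V} {I : Finset V}

theorem card_lt_of_indFree (h : (K2UnionK1s k).IndFree G) (huv : G.Adj u v)
    (hI : G.IsIndepSet (I : Set V)) (hu : ∀ a ∈ I, ¬ G.Adj u a) (hv : ∀ a ∈ I, ¬ G.Adj v a) :
    I.card < k := by
  by_contra! hk
  obtain ⟨f, hf⟩ : ∃ f : Fin k ↪ V, ∀ i, f i ∈ I := by
    obtain ⟨I', hI', hcard⟩ := Finset.exists_subset_card_eq hk
    exact ⟨(I'.equivFinOfCardEq hcard).symm.toEmbedding.trans (.subtype _),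
      fun i => hI' (Subtype.property _)⟩
  have huf : ∀ i, u ≠ f i := fun i he => hv _ (hf i) (he ▸ huv.symm)
  have hvf : ∀ i, v ≠ f i := fun i he => hu _ (hf i) (he ▸ huv)
  have hff : ∀ i j, ¬ G.Adj (f i) (f j) := fun i j hadj => hI (hf i) (hf j) hadj.ne hadj
  refine h ⟨⟨⟨Sum.elim ![u, v] f, Function.Injective.sumElim ?_ f.injective ?_⟩, ?_⟩⟩
  · simp [Function.Injective, Fin.forall_fin_two, huv.ne, huv.ne']
  · simpa [Fin.forall_fin_two] using ⟨huf, hvf⟩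
  · have huf' : ∀ i, ¬ G.Adj (f i) u := fun i hadj => hu _ (hf i) hadj.symm
    have hvf' : ∀ i, ¬ G.Adj (f i) v := fun i hadj => hv _ (hf i) hadj.symm
    simp [K2UnionK1s, Fin.forall_fin_two, huv, huv.symm, hu _ (hf _), hv _ (hf _), huf', hvf',
      hff]

theorem isIndepSet_setOf_forall_not_adj (h : (K2UnionK1s k).IndFree G)
    (hI : G.IsIndepSet (I : Set V)) (hk : k ≤ I.card) :
    G.IsIndepSet {v | ∀ i ∈ I, ¬ G.Adj v i} := fun _ hu _ hv _ huv =>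
  (card_lt_of_indFree h huv hI hu hv).not_ge hk

open Classical in
theorem card_filter_not_adj_lt (h : (K2UnionK1s k).IndFree G) (hI : G.IsIndepSet (I : Set V))
    (hv : ∃ i ∈ I, G.Adj v i) : (I.filter fun a => ¬ G.Adj v a).card < k := by
  obtain ⟨i, hi, hvi⟩ := hv
  have hsub : I.filter (fun a => ¬ G.Adj v a) ⊆ I := Finset.filter_subset _ _
  refine card_lt_of_indFree h hvi (hI.mono (Finset.coe_subset.mpr hsub))
    (fun a ha => (Finset.mem_filter.mp ha).2) fun a ha hia => hI hi (hsub ha) hia.ne hia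

theorem exists_two_common_neighbors (h : (K2UnionK1s k).IndFree G)
    (hI : G.IsIndepSet (I : Set V)) (hk : 2 * k ≤ I.card) (hu : ∃ i ∈ I, G.Adj u i)
    (hv : ∃ i ∈ I, G.Adj v i) :
    ∃ a ∈ I, ∃ b ∈ I, a ≠ b ∧ (G.Adj u a ∧ G.Adj v a) ∧ G.Adj u b ∧ G.Adj v b := by
  classical
  let missed (z : V) : Finset V := I.filter fun a => ¬ G.Adj z a
  have hmissed : (missed u ∪ missed v).card + 1 < I.card := by
    have hu' := card_filter_not_adj_lt h hI hu
    have hv' := card_filter_not_adj_lt h hI hv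
    have := Finset.card_union_le (missed u) (missed v)
    lia
  have hcommon : 1 < (I \ (missed u ∪ missed v)).card := by
    have := Finset.le_card_sdiff (missed u ∪ missed v) I
    lia
  obtain ⟨a, ha, b, hb, hab⟩ := Finset.one_lt_card.mp hcommon
  have hadj : ∀ c ∈ I \ (missed u ∪ missed v), c ∈ I ∧ G.Adj u c ∧ G.Adj v c := by
    simp +contextual [missed]
  exact ⟨a, (hadj a ha).1, b, (hadj b hb).1, hab, (hadj a ha).2, (hadj b hb).2⟩

end Free

theorem exists_isLongestCyclicList [Finite V] {a b : V} (hab : G.Adj a b) :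
    ∃ l, IsLongestCyclicList G l := by
  cases nonempty_fintype V
  have hedge : IsCyclicList G [a, b] := ⟨by simp [hab.ne], a, b, hab.toWalk, rfl, hab.symm⟩
  have hfin : {l | IsCyclicList G l}.Finite :=
    (List.finite_length_le V (Fintype.card V)).subset fun _ hl => hl.nodup.length_le_card
  exact hfin.exists_maximalFor List.length _ ⟨_, hedge⟩

theorem IsLongestCyclicList.isCyclicList {l : List V} (h : IsLongestCyclicList G l) :
    IsCyclicList G l :=
  h.1

theorem IsLongestCyclicList.not_adj_of_coe_support_eq {l m : List V} {a b : V}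
    (h : IsLongestCyclicList G l) (hm : m ≠ []) (hnd : m.Nodup) (hml : m.Disjoint l)
    {p : G.Walk a b} (hp : (p.support : Multiset V) = m + l) : ¬ G.Adj b a := by
  intro hba
  have hperm : p.support.Perm (m ++ l) := Multiset.coe_eq_coe.mp hp
  have hcyc : IsCyclicList G p.support :=
    ⟨hperm.nodup_iff.mpr (hnd.append h.isCyclicList.nodup hml), a, b, p, rfl, hba⟩
  have hlen : p.support.length = m.length + l.length := by simp [hperm.length_eq]
  have := h.2 hcyc (by simp [hlen])
  have := List.length_pos_of_ne_nil hm
  lia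

theorem exists_support_eq_append {c b w : V} (p : G.Walk c b) (hw : w ∈ p.support)
    (hwb : w ≠ b) :
    ∃ d, ∃ (q : G.Walk c w) (r : G.Walk d b), p.support = q.support ++ r.support := by
  classical
  have hnil : ¬ (p.dropUntil w hw).Nil := Walk.not_nil_of_ne hwb
  refine ⟨_, p.takeUntil w hw, (p.dropUntil w hw).tail, ?_⟩
  rw [Walk.support_tail_of_not_nil _ hnil, ← Walk.support_append, Walk.take_spec]

section FormPerm

variable [DecidableEq V] {l m : List V}

theorem formPerm_eq_of_isRotated_support_append {a b c d : V} (hl : l.Nodup) {q : G.Walk a b}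
    {r : G.Walk c d} (hr : l ~r q.support ++ r.support ++ m) : l.formPerm b = c := by
  have hrot : l ~r c :: (r.support.tail ++ m ++ q.support.dropLast) ++ [b] := by
    rw [← q.dropLast_support_concat, ← r.cons_tail_support, List.append_assoc] at hr
    simpa only [List.cons_append, List.append_assoc] using hr.trans List.isRotated_append
  rw [List.formPerm_eq_of_isRotated hl hrot, List.cons_append,
    List.formPerm_cons_concat_apply_last]

theorem exists_support_eq_append_formPerm {b c w : V} (hl : l.Nodup) (p : G.Walk c b)
    (hr : l ~r p.support ++ m) (hw : w ∈ p.support) (hwb : w ≠ b) :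
    ∃ (q : G.Walk c w) (r : G.Walk (l.formPerm w) b), p.support = q.support ++ r.support := by
  obtain ⟨d, q, r, hp⟩ := exists_support_eq_append p hw hwb
  obtain rfl := formPerm_eq_of_isRotated_support_append hl (hp ▸ hr)
  exact ⟨q, r, hp⟩

namespace IsCyclicList

theorem exists_isRotated_support (h : IsCyclicList G l) {a : V} (ha : a ∈ l) :
    ∃ p : G.Walk (l.formPerm a) a, l ~r p.support := by
  obtain ⟨hnd, c, b, p, rfl, hbc⟩ := h
  rcases eq_or_ne a b with rfl | hab
  · have hc : p.support.formPerm a = c := by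
      have := List.formPerm_apply_getLast c p.support.tail
      simpa only [Walk.cons_tail_support, Walk.getLast_support] using this
    exact ⟨p.copy hc.symm rfl, by simp [List.IsRotated.refl]⟩
  · obtain ⟨q, r, hqr⟩ := exists_support_eq_append_formPerm (m := []) hnd p
      (by simp [List.IsRotated.refl]) ha hab
    refine ⟨r.append (.cons hbc q), ?_⟩
    simpa [hqr, Walk.support_append] using List.isRotated_append

theorem exists_isRotated_support_append (h : IsCyclicList G l) {a b : V} (ha : a ∈ l)
    (hb : b ∈ l) (hab : a ≠ b) :
    ∃ (p : G.Walk (l.formPerm a) b) (q : G.Walk (l.formPerm b) a),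
      l ~r p.support ++ q.support := by
  obtain ⟨p, hr⟩ := h.exists_isRotated_support ha
  obtain ⟨q, r, hqr⟩ := exists_support_eq_append_formPerm (m := []) h.nodup p (by simpa using hr)
    (hr.mem_iff.mp hb) hab.symm
  exact ⟨q, r, hqr ▸ hr⟩

theorem exists_isRotated_support_append_append (h : IsCyclicList G l) {a b c : V} (ha : a ∈ l)
    (hb : b ∈ l) (hc : c ∈ l) (hab : a ≠ b) (hac : a ≠ c) (hbc : b ≠ c) :
    (∃ (p : G.Walk (l.formPerm a) b) (q : G.Walk (l.formPerm b) c) (r : G.Walk (l.formPerm c) a),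
      l ~r p.support ++ q.support ++ r.support) ∨
    ∃ (p : G.Walk (l.formPerm a) c) (q : G.Walk (l.formPerm c) b) (r : G.Walk (l.formPerm b) a),
      l ~r p.support ++ q.support ++ r.support := by
  obtain ⟨p, q, hr⟩ := h.exists_isRotated_support_append ha hb hab
  rcases List.mem_append.mp (hr.mem_iff.mp hc) with hc | hc
  · obtain ⟨p₁, p₂, hp⟩ := exists_support_eq_append_formPerm h.nodup p hr hc hbc.symm
    exact .inr ⟨p₁, p₂, q, hp ▸ hr⟩
  · obtain ⟨q₁, q₂, hq⟩ := exists_support_eq_append_formPerm h.nodup q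
      (hr.trans List.isRotated_append) hc hac.symm
    exact .inl ⟨p, q₁, q₂, by simpa [hq] using hr⟩

theorem isHamiltonian [Fintype V] (h : IsCyclicList G l) (hcard : 3 ≤ Fintype.card V)
    (hl : ∀ v, v ∈ l) : G.IsHamiltonian := fun _ => by
  obtain ⟨hnd, a, b, p, rfl, hba⟩ := h
  have hpath : p.IsPath := .mk' hnd
  have hlen := (hpath.isHamiltonian_of_mem hl).length_eq
  have hedge : s(b, a) ∉ p.edges := fun he => by
    have := hpath.length_eq_one_of_mem_edges (Sym2.eq_swap ▸ he)
    lia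
  refine ⟨b, .cons hba p, ?_⟩
  rw [Walk.isHamiltonianCycle_isCycle_and_isHamiltonian_tail, Walk.cons_isCycle_iff]
  refine ⟨⟨hpath, hedge⟩, ?_⟩
  simpa [Walk.IsHamiltonian] using hpath.isHamiltonian_of_mem hl

end IsCyclicList

namespace IsLongestCyclicList

variable {w w' x y : V} {p : G.Walk x y}

theorem formPerm_ne (h : IsLongestCyclicList G l) (hw : w ∈ l) (hp : p.IsPath)
    (hpl : p.support.Disjoint l) (hwx : G.Adj w x) (hyw' : G.Adj y w') : l.formPerm w ≠ w' := by
  rintro rfl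
  obtain ⟨q, hr⟩ := h.isCyclicList.exists_isRotated_support hw
  have hl : (l : Multiset V) = q.support := Multiset.coe_eq_coe.mpr hr.perm
  refine h.not_adj_of_coe_support_eq p.support_ne_nil hp.support_nodup hpl
    (p := q.append (.cons hwx p)) ?_ hyw'
  simp only [Walk.support_append, Walk.support_cons, List.tail_cons, ← Multiset.coe_add, hl]
  abel

theorem not_adj_formPerm (h : IsLongestCyclicList G l) (hw : w ∈ l) (hw' : w' ∈ l)
    (hne : w ≠ w') (hp : p.IsPath) (hpl : p.support.Disjoint l) (hwx : G.Adj w x)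
    (hyw' : G.Adj y w') : ¬ G.Adj (l.formPerm w) (l.formPerm w') := by
  obtain ⟨q, r, hr⟩ := h.isCyclicList.exists_isRotated_support_append hw hw' hne
  have hl : (l : Multiset V) = q.support + r.support := Multiset.coe_eq_coe.mpr hr.perm
  refine h.not_adj_of_coe_support_eq p.support_ne_nil hp.support_nodup hpl
    (p := r.append (.cons hwx (p.append (.cons hyw' q.reverse)))) ?_
  simp only [Walk.support_append, Walk.support_cons, List.tail_cons, Walk.support_reverse,
    ← Multiset.coe_add, Multiset.coe_reverse, hl]
  abel

theorem not_adj_formPerm_of_notMem (h : IsLongestCyclicList G l) (hw : w ∈ l) (hw' : w' ∈ l)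
    (hne : w ≠ w') (hp : p.IsPath) (hpl : p.support.Disjoint l) (hwx : G.Adj w x)
    (hyw' : G.Adj y w') {v : V} (hvl : v ∉ l) (hvp : v ∉ p.support)
    (hv : G.Adj v (l.formPerm w)) : ¬ G.Adj v (l.formPerm w') := by
  intro hv'
  obtain ⟨q, r, hr⟩ := h.isCyclicList.exists_isRotated_support_append hw hw' hne
  have hl : (l : Multiset V) = q.support + r.support := Multiset.coe_eq_coe.mpr hr.perm
  refine h.not_adj_of_coe_support_eq (m := v :: p.support) (by simp) (hp.support_nodup.cons hvp)
    (by simpa using ⟨hvl, hpl⟩)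
    (p := q.reverse.append (.cons hv.symm (.cons hv' (r.append (.cons hwx p))))) ?_ hyw'
  simp only [Walk.support_append, Walk.support_cons, List.tail_cons, Walk.support_reverse,
    ← Multiset.coe_add, ← Multiset.cons_coe, Multiset.coe_reverse, hl,
    ← Multiset.singleton_add]
  abel

theorem not_adj_formPerm_of_isRotated (h : IsLongestCyclicList G l) (hp : p.IsPath)
    (hpl : p.support.Disjoint l) (hwx : G.Adj w x) (hyw' : G.Adj y w') {v : V}
    {q : G.Walk (l.formPerm v) w} {r : G.Walk (l.formPerm w) w'} {s : G.Walk (l.formPerm w') v}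
    (hr : l ~r q.support ++ r.support ++ s.support) (hv : G.Adj v (l.formPerm w)) :
    ¬ G.Adj (l.formPerm v) (l.formPerm w') := by
  have hl : (l : Multiset V) = q.support + r.support + s.support :=
    Multiset.coe_eq_coe.mpr hr.perm
  refine h.not_adj_of_coe_support_eq p.support_ne_nil hp.support_nodup hpl
    (p := s.append (.cons hv (r.append (.cons hyw'.symm
      (p.reverse.append (.cons hwx.symm q.reverse)))))) ?_
  simp only [Walk.support_append, Walk.support_cons, List.tail_cons, Walk.support_reverse,
    ← Multiset.coe_add, Multiset.coe_reverse, hl]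
  abel

theorem not_adj_formPerm_of_adj (h : IsLongestCyclicList G l) (hw : w ∈ l) (hw' : w' ∈ l)
    (hne : w ≠ w') (hp : p.IsPath) (hpl : p.support.Disjoint l) (hwx : G.Adj w x)
    (hyw' : G.Adj y w') {v : V} (hv : v ∈ l) (hvw : v ≠ w) (hvw' : v ≠ w')
    (h₁ : G.Adj v (l.formPerm w)) (h₂ : G.Adj v (l.formPerm w'))
    (h₃ : G.Adj (l.formPerm v) (l.formPerm w)) :
    ¬ G.Adj (l.formPerm v) (l.formPerm w') := fun h₄ => by
  obtain ⟨q, r, s, hr⟩ | ⟨q, r, s, hr⟩ :=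
    h.isCyclicList.exists_isRotated_support_append_append hv hw hw' hvw hvw' hne
  · exact h.not_adj_formPerm_of_isRotated hp hpl hwx hyw' hr h₁ h₄
  · exact h.not_adj_formPerm_of_isRotated hp.reverse (by simpa using hpl) hyw'.symm hwx.symm hr
      h₂ h₃

end IsLongestCyclicList

end FormPerm

section Attachments

variable {l : List V} {x y z w w' v : V}

theorem ReachableOff.notMem (h : ReachableOff G l x y) : y ∉ l := by
  obtain ⟨p, hp⟩ := h
  exact hp p.end_mem_support

theorem ReachableOff.trans_adj (h : ReachableOff G l x y) (hz : z ∉ l) (hyz : G.Adj y z) :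
    ReachableOff G l x z := by
  obtain ⟨p, hp⟩ := h
  refine ⟨p.concat hyz, ?_⟩
  simpa [Walk.support_concat, hp] using hz

theorem ReachableOff.of_mem_support {p : G.Walk x z} (hp : p.support.Disjoint l)
    (hy : y ∈ p.support) : ReachableOff G l x y := by
  classical
  exact ⟨p.takeUntil y hy, fun _ hv => hp (p.support_takeUntil_subset_support hy hv)⟩

theorem mem_attachments :
    w ∈ attachments G l x ↔ w ∈ l ∧ ∃ y, ReachableOff G l x y ∧ G.Adj y w := by
  simp [attachments]

theorem exists_isPath_of_mem_attachments (hw : w ∈ attachments G l x)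
    (hw' : w' ∈ attachments G l x) :
    ∃ (y z : V) (p : G.Walk y z), p.IsPath ∧ (∀ v ∈ p.support, ReachableOff G l x v) ∧
      G.Adj w y ∧ G.Adj z w' := by
  classical
  obtain ⟨-, y, ⟨p, hp⟩, hyw⟩ := mem_attachments.mp hw
  obtain ⟨-, z, ⟨q, hq⟩, hzw'⟩ := mem_attachments.mp hw'
  refine ⟨y, z, (p.reverse.append q).bypass, Walk.bypass_isPath _, fun v hv => ?_, hyw.symm, hzw'⟩
  have hv' := Walk.support_bypass_subset_support _ hv
  rw [Walk.mem_support_append_iff, Walk.support_reverse, List.mem_reverse] at hv'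
  exact hv'.elim (.of_mem_support hp) (.of_mem_support hq)

variable [DecidableEq V]

theorem card_attachmentSuccs : (attachmentSuccs G l x).card = (attachments G l x).card :=
  Finset.card_image_of_injective _ l.formPerm.injective

theorem exists_formPerm_eq_of_mem_attachmentSuccs (hv : v ∈ attachmentSuccs G l x) :
    ∃ w ∈ attachments G l x, w ∈ l ∧ l.formPerm w = v := by
  obtain ⟨w, hw, rfl⟩ := Finset.mem_image.mp hv
  exact ⟨w, hw, (mem_attachments.mp hw).1, rfl⟩

namespace IsLongestCyclicList

theorem formPerm_notMem_attachments (h : IsLongestCyclicList G l)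
    (hw : w ∈ attachments G l x) : l.formPerm w ∉ attachments G l x := fun hw' => by
  obtain ⟨y, z, p, hp, hpx, hwy, hzw⟩ := exists_isPath_of_mem_attachments hw hw'
  exact h.formPerm_ne (mem_attachments.mp hw).1 hp (fun v hv => (hpx v hv).notMem) hwy hzw rfl

theorem not_adj_of_mem_attachmentSuccs (h : IsLongestCyclicList G l)
    (hv : v ∈ attachmentSuccs G l x) (hy : ReachableOff G l x y) : ¬ G.Adj y v := by
  obtain ⟨w, hw, hwl, rfl⟩ := exists_formPerm_eq_of_mem_attachmentSuccs hv
  exact fun hadj => h.formPerm_notMem_attachments hw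
    (mem_attachments.mpr ⟨List.formPerm_apply_mem_of_mem hwl, y, hy, hadj⟩)

theorem isIndepSet_attachmentSuccs (h : IsLongestCyclicList G l) :
    G.IsIndepSet (attachmentSuccs G l x : Set V) := by
  intro a ha b hb hab
  obtain ⟨w, hw, hwl, rfl⟩ := exists_formPerm_eq_of_mem_attachmentSuccs ha
  obtain ⟨w', hw', hwl', rfl⟩ := exists_formPerm_eq_of_mem_attachmentSuccs hb
  obtain ⟨y, z, p, hp, hpx, hwy, hzw⟩ := exists_isPath_of_mem_attachments hw hw'
  exact h.not_adj_formPerm hwl hwl' (ne_of_apply_ne _ hab) hp (fun v hv => (hpx v hv).notMem)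
    hwy hzw

omit [DecidableEq V] in
theorem exists_mem_notMem_attachments (h : IsLongestCyclicList G l) :
    ∃ c ∈ l, c ∉ attachments G l x := by
  classical
  obtain ⟨a, _, p, hp, -⟩ := h.isCyclicList.exists_walk
  have hal : a ∈ l := hp ▸ p.start_mem_support
  by_cases ha : a ∈ attachments G l x
  · exact ⟨_, List.formPerm_apply_mem_of_mem hal, h.formPerm_notMem_attachments ha⟩
  · exact ⟨a, hal, ha⟩

omit [DecidableEq V] in
theorem isCutSet_attachments [Finite V] (h : IsLongestCyclicList G l) (hx : x ∉ l) :
    G.IsCutSet (attachments G l x) := by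
  obtain ⟨c, hc, hcW⟩ := h.exists_mem_notMem_attachments (x := x)
  refine isCutSet_of_forall_walk (x := x) (y := c) (fun hxW => hx (mem_attachments.mp hxW).1) hcW
    fun p => ?_
  obtain ⟨d, hd, hfst, hsnd⟩ := p.exists_boundary_dart {y | ReachableOff G l x y}
    ⟨.nil, by simpa using hx⟩ fun hxc => hxc.notMem hc
  have hdl : d.snd ∈ l := by_contra fun hdl => hsnd (hfst.trans_adj hdl d.adj)
  exact ⟨d.snd, p.dart_snd_mem_support_of_mem_darts hd,
    mem_attachments.mpr ⟨hdl, d.fst, hfst, d.adj⟩⟩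

section Free

variable {k : ℕ} (h : IsLongestCyclicList G l) (hfree : (K2UnionK1s k).IndFree G)
  (hk : 2 * k ≤ (attachments G l x).card)
include h hfree hk

theorem exists_two_common_attachmentSuccs {u v : V} (hu : ∃ i ∈ attachmentSuccs G l x, G.Adj u i)
    (hv : ∃ i ∈ attachmentSuccs G l x, G.Adj v i) :
    ∃ w ∈ attachments G l x, ∃ w' ∈ attachments G l x, w ≠ w' ∧
      (G.Adj u (l.formPerm w) ∧ G.Adj v (l.formPerm w)) ∧
      G.Adj u (l.formPerm w') ∧ G.Adj v (l.formPerm w') := by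
  obtain ⟨a, ha, b, hb, hab, hadj⟩ := exists_two_common_neighbors hfree
    h.isIndepSet_attachmentSuccs (hk.trans_eq card_attachmentSuccs.symm) hu hv
  obtain ⟨w, hw, -, rfl⟩ := exists_formPerm_eq_of_mem_attachmentSuccs ha
  obtain ⟨w', hw', -, rfl⟩ := exists_formPerm_eq_of_mem_attachmentSuccs hb
  exact ⟨w, hw, w', hw', ne_of_apply_ne _ hab, hadj⟩

theorem mem_of_adj_attachmentSuccs (hv : ∃ i ∈ attachmentSuccs G l x, G.Adj v i) : v ∈ l := by
  by_contra hvl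
  obtain ⟨w, hw, w', hw', hne, ⟨hvw, -⟩, hvw', -⟩ :=
    h.exists_two_common_attachmentSuccs hfree hk hv hv
  obtain ⟨y, z, p, hp, hpx, hwy, hzw'⟩ := exists_isPath_of_mem_attachments hw hw'
  have hvp : v ∉ p.support := fun hvp =>
    h.not_adj_of_mem_attachmentSuccs (Finset.mem_image_of_mem _ hw) (hpx v hvp) hvw
  exact h.not_adj_formPerm_of_notMem (mem_attachments.mp hw).1 (mem_attachments.mp hw').1 hne hp
    (fun u hu => (hpx u hu).notMem) hwy hzw' hvl hvp hvw hvw'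

theorem formPerm_not_adj_attachmentSuccs (hv : ∃ i ∈ attachmentSuccs G l x, G.Adj v i) :
    ∀ i ∈ attachmentSuccs G l x, ¬ G.Adj (l.formPerm v) i := by
  by_contra! hσv
  have hvW : ∀ u ∈ attachments G l x, v ≠ u := by
    rintro u hu rfl
    obtain ⟨i, hi, hadj⟩ := hσv
    exact h.isIndepSet_attachmentSuccs (Finset.mem_image_of_mem _ hu) hi hadj.ne hadj
  obtain ⟨w, hw, w', hw', hne, ⟨hvw, hσvw⟩, hvw', hσvw'⟩ :=
    h.exists_two_common_attachmentSuccs hfree hk hv hσv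
  obtain ⟨y, z, p, hp, hpx, hwy, hzw'⟩ := exists_isPath_of_mem_attachments hw hw'
  exact h.not_adj_formPerm_of_adj (mem_attachments.mp hw).1 (mem_attachments.mp hw').1 hne hp
    (fun u hu => (hpx u hu).notMem) hwy hzw' (h.mem_of_adj_attachmentSuccs hfree hk hv)
    (hvW w hw) (hvW w' hw') hvw hvw' hσvw hσvw'

theorem exists_isIndepSet_card_compl_lt_card [Fintype V] (hx : x ∉ l) :
    ∃ J : Finset V, G.IsIndepSet (J : Set V) ∧ Jᶜ.card < J.card := by
  classical
  let J : Finset V := {v | ∀ i ∈ attachmentSuccs G l x, ¬ G.Adj v i}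
  have hmem : ∀ v, v ∈ J ↔ ∀ i ∈ attachmentSuccs G l x, ¬ G.Adj v i := by simp [J]
  have hcompl : ∀ v ∈ Jᶜ, ∃ i ∈ attachmentSuccs G l x, G.Adj v i := by simp [J]
  have hJ : G.IsIndepSet (J : Set V) := by
    have hkI : k ≤ (attachmentSuccs G l x).card := by rw [card_attachmentSuccs]; lia
    simpa [J] using isIndepSet_setOf_forall_not_adj hfree h.isIndepSet_attachmentSuccs hkI
  have hxJ : x ∈ J := (hmem x).mpr fun i hi =>
    h.not_adj_of_mem_attachmentSuccs hi ⟨.nil, by simpa using hx⟩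
  have hsucc : Jᶜ.image l.formPerm ⊂ J := by
    refine Finset.ssubset_iff_subset_ne.mpr ⟨?_, ?_⟩
    · exact Finset.image_subset_iff.mpr fun v hv =>
        (hmem _).mpr (h.formPerm_not_adj_attachmentSuccs hfree hk (hcompl v hv))
    · intro he
      obtain ⟨v, hv, hvx⟩ := Finset.mem_image.mp (he ▸ hxJ)
      exact hx (hvx ▸ List.formPerm_apply_mem_of_mem
        (h.mem_of_adj_attachmentSuccs hfree hk (hcompl v hv)))
  refine ⟨J, hJ, ?_⟩
  rw [← Finset.card_image_of_injective _ l.formPerm.injective]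
  exact Finset.card_lt_card hsucc

end Free

end IsLongestCyclicList

end Attachments

theorem card_le_card_compl_of_isIndepSet [Fintype V] [DecidableEq V] [Nontrivial V]
    (h : G.IsTough 1) {J : Finset V} (hJ : G.IsIndepSet (J : Set V)) : J.card ≤ Jᶜ.card := by
  rcases lt_or_ge J.card 2 with hlt | h2
  · have := Finset.card_add_card_compl J
    have := Fintype.one_lt_card (α := V)
    lia
  · exact_mod_cast one_mul (J.card : ℝ) ▸ mul_card_le_card_compl_of_isIndepSet h hJ h2

end

theorem theorem1_general {V : Type*} [Fintype V] [DecidableEq V] (G : SimpleGraph V) (k : ℕ)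
    (hcard : 3 ≤ Fintype.card V) (htough : G.IsTough 1)
    (hcut : ∀ S : Finset V, G.IsCutSet S → 2 * k ≤ S.card)
    (hfree : (K2UnionK1s k).IndFree G) : G.IsHamiltonian := by
  have : Nontrivial V := Fintype.one_lt_card_iff_nontrivial.mp (by lia)
  obtain ⟨a, b, hab⟩ := exists_adj_of_isTough one_pos htough
  obtain ⟨l, hl⟩ := exists_isLongestCyclicList hab
  refine hl.isCyclicList.isHamiltonian hcard fun x => by_contra fun hx => ?_
  have hk : 2 * k ≤ (attachments G l x).card := hcut _ (hl.isCutSet_attachments hx)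
  obtain ⟨J, hJ, hlt⟩ := hl.exists_isIndepSet_card_compl_lt_card hfree hk hx
  exact hlt.not_ge (card_le_card_compl_of_isIndepSet htough hJ)

theorem theorem1 {V : Type*} [Fintype V] [DecidableEq V] (G : SimpleGraph V)
    (hcard : 3 ≤ Fintype.card V) (htough : G.IsTough 3)
    (hfree : SimpleGraph.K2Union3K1.IndFree G) : G.IsHamiltonian :=
  theorem1_general G 3 hcard (isTough_of_le (by norm_num) htough)
    (fun _ hS => by exact_mod_cast two_mul_le_card_of_isCutSet zero_le_three htough hS) hfree
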